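/- Let $A$ be a nonzero complex $m\times n$ matrix, let $1\le k\le \min\{m,n\}$ be an integer and let $2\le p<\infty$ be real. Let $\sigma_1(X)\ge\sigma_2(X)\ge\dots\ge\sigma_{\min\{m,n\}}(X)\ge 0$ denote the singular values of a complex $m\times n$ matrix $X$, and let $$\|X\|_{(p,k)}=\Big(\sum_{i=1}^k\sigma_i(X)^p\Big)^{1/p}$$ be its Ky Fan $p$-$k$ norm. Let $\partial\|A\|_{(p,k)}$ be the subdifferential of this norm at $A$, that is, the set of all complex-linear functionals $\psi$ on the space of complex $m\times n$ matrices such that $\operatorname{Re}\psi(X-A)\le\|X\|_{(p,k)}-\|A\|_{(p,k)}$ for every complex $m\times n$ matrix $X$. Identify a complex $m\times n$ matrix $G$ with the functional $X\mapsto\operatorname{tr}(G^*X)$. Then $$\partial\|A\|_{(p,k)}=\operatorname{conv}\Big\{\frac{1}{\|A\|_{(p,k)}^{p-1}}\,A\,(A^*A)^{\frac{p-2}{2}}\sum_{i=1}^k v_iv_i^*\ :\ v_1,\dots,v_k\in\mathbb C^n\text{ orthonormal},\ A^*Av_i=\sigma_i(A)^2v_i\text{ for all }1\le i\le k\Big\},$$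 where $(A^*A)^{\frac{p-2}{2}}$ is the real power of the positive semidefinite matrix $A^*A$ (the identity matrix if $p=2$). -/

import Mathlib

open scoped Matrix MatrixOrder ComplexOrder

noncomputable section

/-- The `i`-th singular value of `A`, counted from `0`, in non-increasing order: the value at `i`
is the one usually written `σ_{i+1}(A)`. It vanishes for `i ≥ min m n`. -/
def matSingularValue {m n : ℕ} (A : Matrix (Fin m) (Fin n) ℂ) (i : ℕ) : ℝ :=
  (Matrix.toEuclideanLin A).singularValues i

/-- The Ky Fan `p`-`k` norm `(σ₁(A)^p + ⋯ + σ_k(A)^p)^(1/p)`. -/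
def kyFanNorm {m n : ℕ} (p : ℝ) (k : ℕ) (A : Matrix (Fin m) (Fin n) ℂ) : ℝ :=
  (∑ i : Fin k, matSingularValue A i ^ p) ^ (1 / p)

/-- The subdifferential of `f : E → ℝ` at `a`: the continuous complex-linear functionals `ψ` with
`Re ψ (x - a) ≤ f x - f a` for all `x`. -/
def subdifferential {E : Type*} [AddCommGroup E] [Module ℂ E] [TopologicalSpace E]
    (f : E → ℝ) (a : E) : Set (E →L[ℂ] ℂ) :=
  {ψ | ∀ x : E, (ψ (x - a)).re ≤ f x - f a}

/-- The functional `X ↦ tr (G* X)`, through which the matrix `G` is regarded as an element of the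
dual of the space of `m × n` matrices. -/
def traceFunctional {m n : ℕ} (G : Matrix (Fin m) (Fin n) ℂ) :
    Matrix (Fin m) (Fin n) ℂ →L[ℂ] ℂ where
  toFun X := (Gᴴ * X).trace
  map_add' X Y := by rw [Matrix.mul_add, Matrix.trace_add]
  map_smul' c X := by rw [Matrix.mul_smul, Matrix.trace_smul, RingHom.id_apply]
  cont := by fun_prop

/-- `v₁, …, v_k` are orthonormal in `ℂⁿ` and `A* A v_i = σ_i(A)² v_i` for all `i`. -/
def IsTopRightSingularFamily {m n k : ℕ} (A : Matrix (Fin m) (Fin n) ℂ)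
    (v : Fin k → EuclideanSpace ℂ (Fin n)) : Prop :=
  Orthonormal ℂ v ∧
    ∀ i : Fin k, (Aᴴ * A) *ᵥ (v i).ofLp = ((matSingularValue A i : ℂ) ^ 2) • (v i).ofLp

/-- The matrix `‖A‖^(-(p-1)) A (A* A)^((p-2)/2) ∑ v_i v_i*`, with the Ky Fan `p`-`k` norm and the
real power of the positive semidefinite matrix `A* A` from the functional calculus (so that the
zeroth power is the identity matrix). -/
def kyFanSubgradient {m n k : ℕ} (p : ℝ) (A : Matrix (Fin m) (Fin n) ℂ)
    (v : Fin k → EuclideanSpace ℂ (Fin n)) : Matrix (Fin m) (Fin n) ℂ :=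
  (1 / kyFanNorm p k A ^ (p - 1)) •
    (A * (Aᴴ * A) ^ ((p - 2) / 2) *
      ∑ i : Fin k, Matrix.vecMulVec (v i).ofLp (star (v i).ofLp))

end

/-!
The Ky Fan `p`-`k` norm `N` is a maximum of explicit functions: for `p ≥ 2`,
`N X ^ p = max ∑ ‖X v_i‖ ^ p` over orthonormal `v₁, …, v_k`, attained at eigenvectors of `X* X` for
its `k` largest eigenvalues (`LinearMap.sum_rpow_norm_apply_le`, which is Jensen's inequality for
the doubly substochastic weights `|⟨b_j, v_i⟩|²`, and `IsTopRightSingularFamily.norm_apply`).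

On a family `v` of top right singular vectors of `A`, the matrix `K = kyFanSubgradient p A v` equals
`N A ^ (1 - p) ∑ σ_i ^ (p - 2) (A v_i) v_i*`. Hölder's inequality and the maximum formula give
`Re tr (K* X) ≤ N X` for all `X`, with equality at `X = A`; hence every such `K` is a subgradient,
and so is every convex combination.

Conversely, the set of these `K` is compact, so its convex hull is compact, and a subgradient
`G` outside the hull is strictly separated from it by some direction `X`. This is
impossible: let `v_t` be a top family of `A + t X` and `K_t` the corresponding
subgradient at `A + t X`. The two subgradient inequalities at `A` and at `A + t X` give
`t Re tr (G* X) ≤ N (A + t X) - N A ≤ t Re tr (K_t* X)`. Along some sequence `t → 0` the families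
`v_t` converge, and since singular values depend continuously on the matrix, the limit `v` is a top
family of `A` and `K_t` tends to the subgradient `K` of `v`; thus `Re tr (G* X) ≤ Re tr (K* X)`
(`exists_le_of_mem_subdifferential`). No analysis of the equality cases in the maximum formula is
needed.
-/

open scoped InnerProductSpace
open Module Filter Topology

/-! ### A majorization inequality for singular values -/

section SingularValues

variable {E : Type*} [NormedAddCommGroup E] [InnerProductSpace ℂ E] [FiniteDimensional ℂ E]
  {F : Type*} [NormedAddCommGroup F] [InnerProductSpace ℂ F] [FiniteDimensional ℂ F]

theorem LinearMap.norm_sq_apply_eq_sum_singularValues (T : E →ₗ[ℂ] F) {n : ℕ}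
    (hn : finrank ℂ E = n) (x : E) :
    ‖T x‖ ^ 2 = ∑ j : Fin n, T.singularValues j ^ 2 *
      ‖⟪T.isSymmetric_adjoint_comp_self.eigenvectorBasis hn j, x⟫_ℂ‖ ^ 2 := by
  -- Expand `⟪x, T* T x⟫` in the eigenbasis of `T* T`.
  set hS := T.isSymmetric_adjoint_comp_self
  set b := hS.eigenvectorBasis hn with hb
  have h1 : ((‖T x‖ ^ 2 : ℝ) : ℂ) = ⟪x, (T.adjoint ∘ₗ T) x⟫_ℂ := by
    rw [LinearMap.comp_apply, LinearMap.adjoint_inner_right, inner_self_eq_norm_sq_to_K]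
    norm_cast
  have h2 : ∀ j, ⟪b j, (T.adjoint ∘ₗ T) x⟫_ℂ = (T.singularValues j ^ 2 : ℝ) * ⟪b j, x⟫_ℂ := by
    intro j
    rw [← hS (b j) x, hb, hS.apply_eigenvectorBasis hn j, inner_smul_left,
      T.sq_singularValues_fin hn]
    simp
  have h3 : ((‖T x‖ ^ 2 : ℝ) : ℂ) =
      ((∑ j : Fin n, T.singularValues j ^ 2 * ‖⟪b j, x⟫_ℂ‖ ^ 2 : ℝ) : ℂ) := by
    rw [h1, ← b.sum_inner_mul_inner, Complex.ofReal_sum]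
    refine Finset.sum_congr rfl fun j _ => ?_
    rw [h2, mul_left_comm, ← inner_conj_symm x (b j), RCLike.conj_mul]
    push_cast; rfl
  exact_mod_cast h3

/-- Jensen's inequality for `t ↦ t ^ (p / 2)`, applied to `‖T x‖² = ∑ |⟨b_j, x⟩|² σ_j²`; the
weights sum to `‖x‖² = 1`. -/
theorem LinearMap.rpow_norm_apply_le_sum_singularValues (T : E →ₗ[ℂ] F) {n : ℕ}
    (hn : finrank ℂ E = n) {p : ℝ} (hp : 2 ≤ p) {x : E} (hx : ‖x‖ = 1) :
    ‖T x‖ ^ p ≤ ∑ j : Fin n,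
      ‖⟪T.isSymmetric_adjoint_comp_self.eigenvectorBasis hn j, x⟫_ℂ‖ ^ 2 *
        T.singularValues j ^ p := by
  have key : ∀ t : ℝ, 0 ≤ t → (t ^ 2) ^ (p / 2) = t ^ p := fun t ht => by
    rw [← Real.rpow_natCast, ← Real.rpow_mul ht]; congr 1; push_cast; ring
  have hJ := Real.rpow_arith_mean_le_arith_mean_rpow (p := p / 2) Finset.univ
    (fun j => ‖⟪T.isSymmetric_adjoint_comp_self.eigenvectorBasis hn j, x⟫_ℂ‖ ^ 2)
    (fun j : Fin n => T.singularValues j ^ 2) (fun _ _ => by positivity)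
    (by rw [OrthonormalBasis.sum_sq_norm_inner_right, hx, one_pow])
    (fun _ _ => by positivity) (by linarith)
  calc ‖T x‖ ^ p = (‖T x‖ ^ 2) ^ (p / 2) := (key _ (norm_nonneg _)).symm
    _ ≤ _ := by
      rw [T.norm_sq_apply_eq_sum_singularValues hn]
      simpa only [mul_comm, key _ (T.singularValues_nonneg _)] using hJ

/-- A weighted sum with weights in `[0, 1]` of total mass `k` of a non-increasing sequence is at
most the sum of its first `k` terms. -/
theorem Antitone.sum_weights_mul_le {n k : ℕ} (hk : 1 ≤ k) (hkn : k ≤ n) {μ : ℕ → ℝ}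
    (hμ : Antitone μ) {c : Fin n → ℝ} (h0 : ∀ j, 0 ≤ c j) (h1 : ∀ j, c j ≤ 1)
    (hc : ∑ j, c j = k) : ∑ j : Fin n, c j * μ j ≤ ∑ i : Fin k, μ i := by
  have hs : ∀ f : ℕ → ℝ, ∑ i : Fin k, f i = ∑ j : Fin n, if (j : ℕ) < k then f j else 0 := by
    intro f
    rw [Fin.sum_univ_eq_sum_range f k,
      Fin.sum_univ_eq_sum_range (fun j => if j < k then f j else 0) n, ← Finset.sum_filter]
    refine Finset.sum_congr ?_ fun _ _ => rfl
    ext j; simp only [Finset.mem_range, Finset.mem_filter]; omega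
  -- Each `c j - 1` with `j < k` meets a `μ j ≥ μ (k - 1)`, each other `c j` a `μ j ≤ μ (k - 1)`.
  have h2 : ∑ j : Fin n, (c j - if (j : ℕ) < k then 1 else 0) * (μ j - μ (k - 1)) ≤ 0 := by
    refine Finset.sum_nonpos fun j _ => ?_
    split_ifs with hj
    · exact mul_nonpos_of_nonpos_of_nonneg (by linarith [h1 j])
        (sub_nonneg.2 (hμ (by omega)))
    · exact mul_nonpos_of_nonneg_of_nonpos (by linarith [h0 j])
        (sub_nonpos.2 (hμ (by omega)))
  have h3 : ∑ j : Fin n, (c j - if (j : ℕ) < k then 1 else 0) = 0 := by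
    rw [Finset.sum_sub_distrib, hc, ← hs fun _ => 1]; simp
  rw [hs]
  simp only [mul_sub, Finset.sum_sub_distrib (f := fun j => _ * μ _), ← Finset.sum_mul, h3] at h2
  simp only [sub_mul, Finset.sum_sub_distrib, ite_mul, one_mul, zero_mul] at h2
  linarith

/-- The upper bound in the maximum formula for the Ky Fan `p`-`k` norm. -/
theorem LinearMap.sum_rpow_norm_apply_le (T : E →ₗ[ℂ] F) {k : ℕ} {p : ℝ} (hp : 2 ≤ p)
    {v : Fin k → E} (hv : Orthonormal ℂ v) :
    ∑ i, ‖T (v i)‖ ^ p ≤ ∑ i : Fin k, T.singularValues i ^ p := by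
  rcases Nat.eq_zero_or_pos k with rfl | hk
  · simp
  have hkn : k ≤ finrank ℂ E := by simpa using hv.linearIndependent.fintype_card_le_finrank
  set b := T.isSymmetric_adjoint_comp_self.eigenvectorBasis rfl
  calc ∑ i, ‖T (v i)‖ ^ p
      ≤ ∑ i, ∑ j, ‖⟪b j, v i⟫_ℂ‖ ^ 2 * T.singularValues j ^ p :=
        Finset.sum_le_sum fun i _ => T.rpow_norm_apply_le_sum_singularValues rfl hp (hv.1 i)
    _ = ∑ j, (∑ i, ‖⟪b j, v i⟫_ℂ‖ ^ 2) * T.singularValues j ^ p := by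
        rw [Finset.sum_comm]; simp only [Finset.sum_mul]
    _ ≤ _ := by
      refine Antitone.sum_weights_mul_le (μ := fun j => T.singularValues j ^ p) hk hkn
        (fun i j hij => Real.rpow_le_rpow (T.singularValues_nonneg _)
          (T.singularValues_antitone hij) (by linarith))
        (fun j => by positivity) (fun j => ?_) ?_
      · have := hv.sum_inner_products_le (b j) (s := Finset.univ)
        rw [b.orthonormal.1, one_pow] at this
        simpa only [norm_inner_symm] using this
      · rw [Finset.sum_comm]
        simp [b.sum_sq_norm_inner_right, hv.1]

end SingularValues

/-! ### Convex hulls of compact sets in finite dimension -/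

section ConvexHull

open Set

/-- By Carathéodory's theorem, the convex hull is the image of the compact set of all pairs of
`finrank + 1` weights and as many points of `s`. -/
theorem IsCompact.convexHull_of_finiteDimensional {E : Type*} [AddCommGroup E] [Module ℝ E]
    [TopologicalSpace E] [IsTopologicalAddGroup E] [ContinuousSMul ℝ E] [FiniteDimensional ℝ E]
    {s : Set E} (hs : IsCompact s) : IsCompact (convexHull ℝ s) := by
  rcases s.eq_empty_or_nonempty with rfl | ⟨x₀, hx₀⟩
  · simp
  set d := finrank ℝ E + 1
  have himg : convexHull ℝ s = (fun q : (Fin d → ℝ) × (Fin d → E) => ∑ i, q.1 i • q.2 i) ''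
      (stdSimplex ℝ (Fin d) ×ˢ Set.univ.pi fun _ => s) := by
    apply Set.Subset.antisymm
    · intro x hx
      obtain ⟨ι, _, z, w, hz, hind, hw, hw1, hx⟩ := eq_pos_convex_span_of_mem_convexHull hx
      have hcard : Fintype.card ι ≤ Fintype.card (Fin d) := by
        rw [Fintype.card_fin]
        exact hind.card_le_finrank_succ.trans (Nat.succ_le_succ (Submodule.finrank_le _))
      obtain ⟨e⟩ := Function.Embedding.nonempty_of_card_le hcard
      -- Pad an affinely independent family to length `d`: weights by `0`, points by `x₀`.
      have hw0 : ∀ i ∉ range e, Function.extend e w 0 i = 0 := fun i hi =>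
        Function.extend_apply' _ _ _ fun h => hi h
      refine ⟨(Function.extend e w 0, Function.extend e z fun _ => x₀),
        ⟨⟨fun i => ?_, ?_⟩, fun i _ => ?_⟩, ?_⟩
      · by_cases h : ∃ a, e a = i
        · obtain ⟨a, rfl⟩ := h
          simpa only [e.injective.extend_apply] using (hw a).le
        · simp [Function.extend_apply' _ _ _ h]
      · rw [← hw1]
        exact (Fintype.sum_of_injective e e.injective _ _ hw0
          fun i => (e.injective.extend_apply _ _ i).symm).symm
      · by_cases h : ∃ a, e a = i
        · obtain ⟨a, rfl⟩ := h
          simpa only [e.injective.extend_apply] using hz (mem_range_self a)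
        · simpa only [Function.extend_apply' _ _ _ h] using hx₀
      · rw [← hx]
        refine (Fintype.sum_of_injective e e.injective _ _ (fun i hi => ?_) fun i => ?_).symm
        · simp only [hw0 i hi, zero_smul]
        · simp only [e.injective.extend_apply]
    · rintro _ ⟨⟨w, z⟩, ⟨hw, hz⟩, rfl⟩
      exact (convex_convexHull ℝ s).sum_mem (fun i _ => hw.1 i) hw.2
        fun i _ => subset_convexHull ℝ s (hz i (mem_univ i))
  rw [himg]
  exact ((isCompact_stdSimplex ℝ (Fin d)).prod (isCompact_univ_pi fun _ => hs)).image (by fun_prop)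
end ConvexHull

/-! ### The functional calculus on eigenvectors -/

/-- The spectrum is finite, so `f` may be replaced by an interpolating polynomial. The node `r` is
added because it lies in the spectrum only if `v ≠ 0`. -/
theorem Matrix.cfc_mulVec_of_mulVec_eq_smul {n : ℕ} {a : Matrix (Fin n) (Fin n) ℂ}
    (ha : IsSelfAdjoint a) (f : ℝ → ℝ) {r : ℝ} {v : Fin n → ℂ} (hv : a *ᵥ v = (r : ℂ) • v) :
    cfc f a *ᵥ v = (f r : ℂ) • v := by
  classical
  have hfin : (insert r (spectrum ℝ a)).Finite := (Matrix.finite_real_spectrum).insert r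
  set q := Lagrange.interpolate hfin.toFinset id f
  have hq : ∀ x ∈ insert r (spectrum ℝ a), q.eval x = f x := fun x hx =>
    Lagrange.eval_interpolate_at_node f Function.injective_id.injOn (hfin.mem_toFinset.2 hx)
  have hcfc : cfc f a = Polynomial.aeval a q := by
    rw [← cfc_polynomial q a ha]
    exact cfc_congr fun x hx => (hq x (Set.mem_insert_of_mem _ hx)).symm
  have hpow : ∀ m : ℕ, a ^ m *ᵥ v = ((r ^ m : ℝ) : ℂ) • v := by
    intro m
    induction m with
    | zero => simp
    | succ m ih =>
      rw [pow_succ, ← Matrix.mulVec_mulVec, hv, Matrix.mulVec_smul, ih, smul_smul]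
      congr 1; push_cast; ring
  rw [hcfc, ← hq r (Set.mem_insert _ _), Polynomial.aeval_eq_sum_range,
    Polynomial.eval_eq_sum_range, Matrix.sum_mulVec, Complex.ofReal_sum, Finset.sum_smul]
  refine Finset.sum_congr rfl fun i _ => ?_
  rw [Matrix.smul_mulVec, hpow, ← Complex.coe_smul, smul_smul]
  push_cast; rfl

/-! ### The trace pairing -/

theorem traceFunctional_apply {m n : ℕ} (G X : Matrix (Fin m) (Fin n) ℂ) :
    traceFunctional G X = (Gᴴ * X).trace := rfl

theorem traceFunctional_surjective (m n : ℕ) :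
    Function.Surjective (traceFunctional (m := m) (n := n)) := by
  intro ψ
  refine ⟨Matrix.of fun i j => star (ψ (Matrix.single i j 1)), ?_⟩
  ext X
  conv_rhs => rw [Matrix.matrix_eq_sum_single X]
  simp only [map_sum]
  rw [traceFunctional_apply]
  rw [Matrix.trace, Finset.sum_comm]
  refine Finset.sum_congr rfl fun j _ => ?_
  rw [Matrix.diag_apply, Matrix.mul_apply]
  refine Finset.sum_congr rfl fun i _ => ?_
  have hs : Matrix.single i j (X i j) = X i j • Matrix.single i j 1 := by simp
  rw [hs, map_smul]
  simp [mul_comm]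

theorem re_traceFunctional_comm {m n : ℕ} (G X : Matrix (Fin m) (Fin n) ℂ) :
    (traceFunctional G X).re = (traceFunctional X G).re := by
  rw [traceFunctional_apply, traceFunctional_apply, ← Complex.conj_re (Xᴴ * G).trace,
    starRingEnd_apply, ← Matrix.trace_conjTranspose]
  simp

section KyFan

variable {m n k : ℕ}

/-! ### Families of top right singular vectors -/

theorem matSingularValue_nonneg (A : Matrix (Fin m) (Fin n) ℂ) (i : ℕ) :
    0 ≤ matSingularValue A i := LinearMap.singularValues_nonneg _ _

theorem conjTranspose_mul_mulVec_eq (A : Matrix (Fin m) (Fin n) ℂ) (v : EuclideanSpace ℂ (Fin n)) :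
    (Aᴴ * A) *ᵥ v.ofLp =
      (((Matrix.toEuclideanLin A).adjoint ∘ₗ Matrix.toEuclideanLin A) v).ofLp := by
  rw [← Matrix.toEuclideanLin_conjTranspose_eq_adjoint, LinearMap.comp_apply]
  simp [Matrix.mulVec_mulVec]

theorem isClosed_setOf_orthonormal : IsClosed {v : Fin k → EuclideanSpace ℂ (Fin n) |
    Orthonormal ℂ v} := by
  simp only [orthonormal_iff_ite, Set.ofPred_forall]
  exact isClosed_iInter fun i => isClosed_iInter fun j =>
    isClosed_eq (by fun_prop) continuous_const

theorem isCompact_setOf_orthonormal : IsCompact {v : Fin k → EuclideanSpace ℂ (Fin n) |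
    Orthonormal ℂ v} := by
  refine (isCompact_univ_pi fun _ => isCompact_closedBall
    (0 : EuclideanSpace ℂ (Fin n)) 1).of_isClosed_subset isClosed_setOf_orthonormal ?_
  intro v hv i _
  simp [hv.1 i]

theorem exists_isTopRightSingularFamily (hkn : k ≤ n) (A : Matrix (Fin m) (Fin n) ℂ) :
    ∃ v : Fin k → EuclideanSpace ℂ (Fin n), IsTopRightSingularFamily A v := by
  set T := Matrix.toEuclideanLin A with hT
  have hn : finrank ℂ (EuclideanSpace ℂ (Fin n)) = n := finrank_euclideanSpace_fin
  set b := T.isSymmetric_adjoint_comp_self.eigenvectorBasis hn with hb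
  refine ⟨fun i => b (Fin.castLE hkn i),
    b.orthonormal.comp _ (Fin.castLE_injective hkn), fun i => ?_⟩
  rw [conjTranspose_mul_mulVec_eq, ← hT, hb, LinearMap.IsSymmetric.apply_eigenvectorBasis,
    ← T.sq_singularValues_fin hn]
  simp [matSingularValue, ← hT]

namespace IsTopRightSingularFamily

variable {A : Matrix (Fin m) (Fin n) ℂ} {v : Fin k → EuclideanSpace ℂ (Fin n)}

theorem norm_apply (hv : IsTopRightSingularFamily A v) (i : Fin k) :
    ‖Matrix.toEuclideanLin A (v i)‖ = matSingularValue A i := by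
  have h := hv.2 i
  rw [conjTranspose_mul_mulVec_eq] at h
  have h' : ((Matrix.toEuclideanLin A).adjoint ∘ₗ Matrix.toEuclideanLin A) (v i) =
    ((matSingularValue A i : ℂ) ^ 2) • v i := by
      ext1; simpa using congrFun h _
  have h1 : ((‖Matrix.toEuclideanLin A (v i)‖ ^ 2 : ℝ) : ℂ) =
      ((matSingularValue A i ^ 2 : ℝ) : ℂ) := by
    rw [Complex.ofReal_pow, Complex.ofReal_pow,
      ← Complex.coe_algebraMap, ← inner_self_eq_norm_sq_to_K (𝕜 := ℂ),
      ← LinearMap.adjoint_inner_right, ← LinearMap.comp_apply, h',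
      inner_smul_right, inner_self_eq_norm_sq_to_K, hv.1.1 i]
    simp
  have h2 : ‖Matrix.toEuclideanLin A (v i)‖ ^ 2 = matSingularValue A i ^ 2 := by exact_mod_cast h1
  exact (sq_eq_sq₀ (norm_nonneg _) (matSingularValue_nonneg _ _)).1 h2

theorem kyFanSubgradient_eq (hv : IsTopRightSingularFamily A v) (p : ℝ) :
    kyFanSubgradient p A v = (1 / kyFanNorm p k A ^ (p - 1)) •
      ∑ i : Fin k, (matSingularValue A i ^ (p - 2)) •
        Matrix.vecMulVec (A *ᵥ (v i).ofLp) (star (v i).ofLp) := by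
  have hA := (Matrix.posSemidef_conjTranspose_mul_self A)
  have hpow : ∀ i, (Aᴴ * A) ^ ((p - 2) / 2) *ᵥ (v i).ofLp =
      ((matSingularValue A i ^ (p - 2) : ℝ) : ℂ) • (v i).ofLp := by
    intro i
    rw [CFC.rpow_eq_cfc_real hA.nonneg, Matrix.cfc_mulVec_of_mulVec_eq_smul hA.1
      (r := matSingularValue A i ^ 2) _ (by rw [hv.2 i]; push_cast; rfl)]
    rw [← Real.rpow_natCast, ← Real.rpow_mul (matSingularValue_nonneg _ _)]
    congr 3; push_cast; ring
  rw [kyFanSubgradient, Matrix.mul_sum]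
  congr 1
  refine Finset.sum_congr rfl fun i _ => ?_
  rw [Matrix.mul_vecMulVec, ← Matrix.mulVec_mulVec, hpow, Matrix.mulVec_smul,
    Matrix.smul_vecMulVec, Complex.coe_smul]

theorem re_traceFunctional_kyFanSubgradient (hv : IsTopRightSingularFamily A v) (p : ℝ)
    (X : Matrix (Fin m) (Fin n) ℂ) :
    (traceFunctional (kyFanSubgradient p A v) X).re = (1 / kyFanNorm p k A ^ (p - 1)) *
      ∑ i : Fin k, matSingularValue A i ^ (p - 2) *
        (⟪Matrix.toEuclideanLin A (v i), Matrix.toEuclideanLin X (v i)⟫_ℂ).re := by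
  rw [traceFunctional_apply]
  have h : ∀ i, ((Matrix.vecMulVec (A *ᵥ (v i).ofLp) (star (v i).ofLp))ᴴ * X).trace =
      ⟪Matrix.toEuclideanLin A (v i), Matrix.toEuclideanLin X (v i)⟫_ℂ := by
    intro i
    rw [Matrix.conjTranspose_vecMulVec, star_star, Matrix.vecMulVec_mul, Matrix.trace_vecMulVec,
      dotProduct_comm, ← Matrix.dotProduct_mulVec, dotProduct_comm]
    simp [EuclideanSpace.inner_eq_star_dotProduct]
  simp only [hv.kyFanSubgradient_eq, Matrix.conjTranspose_smul, Matrix.conjTranspose_sum,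
    Matrix.smul_mul, Matrix.sum_mul, Matrix.trace_smul, Matrix.trace_sum, h, star_trivial,
    Complex.smul_re, Complex.re_sum, smul_eq_mul]

end IsTopRightSingularFamily

/-! ### Continuity of the singular values -/

theorem Continuous.toEuclideanLin_apply {X : Type*} [TopologicalSpace X]
    {B : X → Matrix (Fin m) (Fin n) ℂ} {x : X → EuclideanSpace ℂ (Fin n)}
    (hB : Continuous B) (hx : Continuous x) :
    Continuous fun j => Matrix.toEuclideanLin (B j) (x j) := by
  simp only [Matrix.toLpLin_apply]
  fun_prop

theorem Filter.Tendsto.toEuclideanLin_apply {ι : Type*} {l : Filter ι}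
    {B : ι → Matrix (Fin m) (Fin n) ℂ} {x : ι → EuclideanSpace ℂ (Fin n)}
    {A : Matrix (Fin m) (Fin n) ℂ} {y : EuclideanSpace ℂ (Fin n)}
    (hB : Tendsto B l (𝓝 A)) (hx : Tendsto x l (𝓝 y)) :
    Tendsto (fun j => Matrix.toEuclideanLin (B j) (x j)) l (𝓝 (Matrix.toEuclideanLin A y)) := by
  have h := (Continuous.toEuclideanLin_apply continuous_fst continuous_snd).tendsto (A, y)
  have h1 := h.comp (hB.prodMk_nhds hx)
  exact h1

theorem isGreatest_sum_sq_matSingularValue (hkn : k ≤ n) (A : Matrix (Fin m) (Fin n) ℂ) :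
    IsGreatest ((fun v : Fin k → EuclideanSpace ℂ (Fin n) =>
      ∑ i, ‖Matrix.toEuclideanLin A (v i)‖ ^ 2) '' {v | Orthonormal ℂ v})
      (∑ i : Fin k, matSingularValue A i ^ 2) := by
  constructor
  · obtain ⟨v, hv⟩ := exists_isTopRightSingularFamily hkn A
    exact ⟨v, hv.1, by simp only [hv.norm_apply]⟩
  · rintro _ ⟨v, hv, rfl⟩
    simpa [matSingularValue] using
      (Matrix.toEuclideanLin A).sum_rpow_norm_apply_le (p := 2) le_rfl hv

/-- A maximum over a compact set of a jointly continuous function is continuous. -/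
theorem continuous_sum_sq_matSingularValue (hkn : k ≤ n) :
    Continuous fun A : Matrix (Fin m) (Fin n) ℂ => ∑ i : Fin k, matSingularValue A i ^ 2 := by
  simp only [← (isGreatest_sum_sq_matSingularValue hkn _).csSup_eq]
  refine IsCompact.continuous_sSup isCompact_setOf_orthonormal ?_
  have h : Continuous fun q : Matrix (Fin m) (Fin n) ℂ × (Fin k → EuclideanSpace ℂ (Fin n)) =>
      ∑ i, ‖Matrix.toEuclideanLin q.1 (q.2 i)‖ ^ 2 :=
    continuous_finsetSum _ fun i _ => (Continuous.toEuclideanLin_apply continuous_fst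
      ((continuous_apply i).comp continuous_snd)).norm.pow 2
  exact h

/-- The square of a singular value is a difference of two consecutive sums of squares. -/
@[fun_prop]
theorem continuous_matSingularValue (i : ℕ) :
    Continuous fun A : Matrix (Fin m) (Fin n) ℂ => matSingularValue A i := by
  rcases lt_or_ge i n with hi | hi
  · have h := ((continuous_sum_sq_matSingularValue (m := m) (Nat.succ_le_of_lt hi)).sub
      (continuous_sum_sq_matSingularValue hi.le)).sqrt
    refine h.congr fun A => ?_
    simp only [Pi.sub_apply, Nat.succ_eq_add_one]
    rw [Fin.sum_univ_castSucc]
    simp [Real.sqrt_sq (matSingularValue_nonneg A i)]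
  · refine continuous_const.congr (f := fun _ => (0 : ℝ)) fun A => ?_
    exact (LinearMap.singularValues_of_finrank_le _ (by simpa using hi)).symm

/-! ### The Ky Fan norm and its subgradients -/

theorem sum_matSingularValue_rpow_nonneg (p : ℝ) (A : Matrix (Fin m) (Fin n) ℂ) :
    0 ≤ ∑ i : Fin k, matSingularValue A i ^ p :=
  Finset.sum_nonneg fun _ _ => Real.rpow_nonneg (matSingularValue_nonneg _ _) _

theorem kyFanNorm_nonneg (p : ℝ) (A : Matrix (Fin m) (Fin n) ℂ) : 0 ≤ kyFanNorm p k A :=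
  Real.rpow_nonneg (sum_matSingularValue_rpow_nonneg _ _) _

theorem kyFanNorm_rpow {p : ℝ} (hp : p ≠ 0) (A : Matrix (Fin m) (Fin n) ℂ) :
    kyFanNorm p k A ^ p = ∑ i : Fin k, matSingularValue A i ^ p := by
  rw [kyFanNorm, ← Real.rpow_mul (sum_matSingularValue_rpow_nonneg _ _), one_div_mul_cancel hp,
    Real.rpow_one]

theorem kyFanNorm_pos (hk : 1 ≤ k) {p : ℝ} {A : Matrix (Fin m) (Fin n) ℂ} (hA : A ≠ 0) :
    0 < kyFanNorm p k A := by
  have h0 : 0 < matSingularValue A 0 := by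
    refine (matSingularValue_nonneg A 0).lt_of_ne' fun h => hA ?_
    have : (Matrix.toEuclideanLin A).singularValues = 0 := by
      ext i
      exact le_antisymm (((Matrix.toEuclideanLin A).singularValues_antitone (Nat.zero_le i)).trans
        h.le) (LinearMap.singularValues_nonneg _ _)
    simpa using this
  have hsum : 0 < ∑ i : Fin k, matSingularValue A i ^ p :=
    Finset.sum_pos' (fun i _ => Real.rpow_nonneg (matSingularValue_nonneg _ _) _)
      ⟨(⟨0, hk⟩ : Fin k), Finset.mem_univ _, Real.rpow_pos_of_pos h0 _⟩
  exact Real.rpow_pos_of_pos hsum _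

theorem continuous_kyFanNorm {p : ℝ} (hp : 0 ≤ p) :
    Continuous fun A : Matrix (Fin m) (Fin n) ℂ => kyFanNorm p k A := by
  unfold kyFanNorm
  refine (continuous_finsetSum _ fun i _ => ?_).rpow_const fun _ => Or.inr (by positivity)
  exact (continuous_matSingularValue _).rpow_const fun _ => Or.inr hp

theorem isClosed_setOf_isTopRightSingularFamily :
    IsClosed {q : Matrix (Fin m) (Fin n) ℂ × (Fin k → EuclideanSpace ℂ (Fin n)) |
      IsTopRightSingularFamily q.1 q.2} := by
  simp only [IsTopRightSingularFamily, Set.ofPred_and, Set.ofPred_forall]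
  refine (isClosed_setOf_orthonormal.preimage continuous_snd).inter
    (isClosed_iInter fun i => isClosed_eq (by fun_prop) (by fun_prop))

theorem isCompact_setOf_kyFanSubgradient (p : ℝ) (A : Matrix (Fin m) (Fin n) ℂ) :
    IsCompact {K : Matrix (Fin m) (Fin n) ℂ | ∃ v : Fin k → EuclideanSpace ℂ (Fin n),
      IsTopRightSingularFamily A v ∧ K = kyFanSubgradient p A v} := by
  have hc : IsCompact {v : Fin k → EuclideanSpace ℂ (Fin n) | IsTopRightSingularFamily A v} :=
    isCompact_setOf_orthonormal.of_isClosed_subset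
      (isClosed_setOf_isTopRightSingularFamily.preimage (by fun_prop : Continuous fun v => (A, v)))
      fun v hv => hv.1
  have hcont : Continuous fun v : Fin k → EuclideanSpace ℂ (Fin n) => kyFanSubgradient p A v := by
    unfold kyFanSubgradient
    fun_prop
  convert hc.image hcont using 1
  ext K
  simp only [Set.mem_image, Set.mem_ofPred_eq, eq_comm]

/-- Hölder's inequality for `p` and `p / (p - 1)`, combined with the maximum formula for the norm of
`X`: the functional of a Ky Fan subgradient has dual norm at most `1`. -/
theorem IsTopRightSingularFamily.re_traceFunctional_le {A : Matrix (Fin m) (Fin n) ℂ}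
    {v : Fin k → EuclideanSpace ℂ (Fin n)} (hv : IsTopRightSingularFamily A v) {p : ℝ}
    (hp : 2 ≤ p) (hA : 0 < kyFanNorm p k A) (X : Matrix (Fin m) (Fin n) ℂ) :
    (traceFunctional (kyFanSubgradient p A v) X).re ≤ kyFanNorm p k X := by
  have hpq : p.HolderConjugate (p / (p - 1)) := Real.HolderConjugate.conjExponent (by linarith)
  rw [hv.re_traceFunctional_kyFanSubgradient, div_mul_eq_mul_div, one_mul, div_le_iff₀
    (Real.rpow_pos_of_pos hA _)]
  calc ∑ i : Fin k, matSingularValue A i ^ (p - 2) *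
        (⟪Matrix.toEuclideanLin A (v i), Matrix.toEuclideanLin X (v i)⟫_ℂ).re
      ≤ ∑ i : Fin k, ‖Matrix.toEuclideanLin X (v i)‖ * matSingularValue A i ^ (p - 1) := by
        refine Finset.sum_le_sum fun i _ => ?_
        have hσ := matSingularValue_nonneg A i
        calc _ ≤ matSingularValue A i ^ (p - 2) *
              (matSingularValue A i * ‖Matrix.toEuclideanLin X (v i)‖) := by
              rw [← hv.norm_apply i]
              gcongr
              exact re_inner_le_norm (𝕜 := ℂ) _ _
          _ = _ := by
              have : matSingularValue A i ^ (p - 1) =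
                  matSingularValue A i ^ (p - 2) * matSingularValue A i := by
                rw [← Real.rpow_add_one' hσ (by linarith)]; congr 1; ring
              rw [this]; ring
    _ ≤ (∑ i, ‖Matrix.toEuclideanLin X (v i)‖ ^ p) ^ (1 / p) *
          (∑ i : Fin k, (matSingularValue A i ^ (p - 1)) ^ (p / (p - 1))) ^ (1 / (p / (p - 1))) :=
        Real.inner_le_Lp_mul_Lq_of_nonneg _ hpq (fun _ _ => norm_nonneg _)
          fun i _ => Real.rpow_nonneg (matSingularValue_nonneg A i) _
    _ ≤ kyFanNorm p k X * kyFanNorm p k A ^ (p - 1) := by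
        have h1 : ∀ i : Fin k, (matSingularValue A i ^ (p - 1)) ^ (p / (p - 1)) =
            matSingularValue A i ^ p := fun i => by
          rw [← Real.rpow_mul (matSingularValue_nonneg A i), mul_div_cancel₀ _ (by linarith)]
        simp only [h1]
        rw [← kyFanNorm_rpow (by linarith) A, ← Real.rpow_mul hA.le]
        have h2 : p * (1 / (p / (p - 1))) = p - 1 := by field_simp
        rw [h2]
        refine mul_le_mul_of_nonneg_right ?_ (Real.rpow_nonneg hA.le _)
        exact Real.rpow_le_rpow (Finset.sum_nonneg fun _ _ => by positivity)
          ((Matrix.toEuclideanLin X).sum_rpow_norm_apply_le hp hv.1) (by positivity)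

theorem IsTopRightSingularFamily.re_traceFunctional_self {A : Matrix (Fin m) (Fin n) ℂ}
    {v : Fin k → EuclideanSpace ℂ (Fin n)} (hv : IsTopRightSingularFamily A v) {p : ℝ}
    (hp : 2 ≤ p) (hA : 0 < kyFanNorm p k A) :
    (traceFunctional (kyFanSubgradient p A v) A).re = kyFanNorm p k A := by
  have h : ∀ i : Fin k, matSingularValue A i ^ (p - 2) *
      (⟪Matrix.toEuclideanLin A (v i), Matrix.toEuclideanLin A (v i)⟫_ℂ).re =
      matSingularValue A i ^ p := fun i => by
    have : (⟪Matrix.toEuclideanLin A (v i), Matrix.toEuclideanLin A (v i)⟫_ℂ).re =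
        matSingularValue A i ^ (2 : ℝ) := by
      rw [← hv.norm_apply i, Real.rpow_ofNat]; exact inner_self_eq_norm_sq (𝕜 := ℂ) _
    rw [this, ← Real.rpow_add' (matSingularValue_nonneg A i) (by linarith)]
    congr 1; ring
  rw [hv.re_traceFunctional_kyFanSubgradient, Finset.sum_congr rfl fun i _ => h i,
    ← kyFanNorm_rpow (by linarith) A, div_mul_eq_mul_div, one_mul,
    ← Real.rpow_sub hA]
  simp

theorem IsTopRightSingularFamily.traceFunctional_mem_subdifferential
    {A : Matrix (Fin m) (Fin n) ℂ} {v : Fin k → EuclideanSpace ℂ (Fin n)}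
    (hv : IsTopRightSingularFamily A v) {p : ℝ} (hp : 2 ≤ p) (hA : 0 < kyFanNorm p k A) :
    traceFunctional (kyFanSubgradient p A v) ∈ subdifferential (kyFanNorm p k) A := by
  intro X
  rw [map_sub, Complex.sub_re, hv.re_traceFunctional_self hp hA]
  linarith [hv.re_traceFunctional_le hp hA X]

theorem convex_subdifferential {E : Type*} [AddCommGroup E] [Module ℂ E] [TopologicalSpace E]
    [ContinuousAdd E] [ContinuousConstSMul ℂ E]
    (f : E → ℝ) (a : E) : Convex ℝ (subdifferential f a) := by
  intro φ hφ ψ hψ s t hs ht hst x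
  have h := add_le_add (mul_le_mul_of_nonneg_left (hφ x) hs) (mul_le_mul_of_nonneg_left (hψ x) ht)
  rw [← add_mul, hst, one_mul] at h
  simpa using h

/-- Joint continuity of the subgradient in the matrix and the family of vectors, tested against a
fixed matrix. The exponent `p - 2` is nonnegative, so vanishing singular values do no harm. -/
theorem IsTopRightSingularFamily.tendsto_re_traceFunctional {ι : Type*} {l : Filter ι}
    {p : ℝ} (hp : 2 ≤ p) {B : ι → Matrix (Fin m) (Fin n) ℂ}
    {w : ι → Fin k → EuclideanSpace ℂ (Fin n)} {A : Matrix (Fin m) (Fin n) ℂ}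
    {v : Fin k → EuclideanSpace ℂ (Fin n)} (hA : kyFanNorm p k A ≠ 0)
    (hB : Tendsto B l (𝓝 A)) (hw : Tendsto w l (𝓝 v))
    (hBw : ∀ j, IsTopRightSingularFamily (B j) (w j)) (hv : IsTopRightSingularFamily A v)
    (X : Matrix (Fin m) (Fin n) ℂ) :
    Tendsto (fun j => (traceFunctional (kyFanSubgradient p (B j) (w j)) X).re) l
      (𝓝 (traceFunctional (kyFanSubgradient p A v) X).re) := by
  simp only [(hBw _).re_traceFunctional_kyFanSubgradient, hv.re_traceFunctional_kyFanSubgradient]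
  have hw' : ∀ i, Tendsto (fun j => w j i) l (𝓝 (v i)) := fun i => tendsto_pi_nhds.1 hw i
  refine Tendsto.mul ?_ (tendsto_finsetSum _ fun i _ => Tendsto.mul ?_ ?_)
  · refine Tendsto.div tendsto_const_nhds ?_
      (Real.rpow_pos_of_pos ((kyFanNorm_nonneg _ _).lt_of_ne' hA) _).ne'
    have h1 := ((continuous_kyFanNorm (k := k) (by linarith : 0 ≤ p)).tendsto A).comp hB
    exact h1.rpow_const (Or.inl hA)
  · have h1 := ((continuous_matSingularValue i).tendsto A).comp hB
    exact h1.rpow_const (Or.inr (by linarith))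
  · have h1 := (hB.toEuclideanLin_apply (hw' i)).inner (𝕜 := ℂ)
      ((tendsto_const_nhds (x := X)).toEuclideanLin_apply (hw' i))
    exact (Complex.continuous_re.tendsto _).comp h1

/-! ### The subdifferential -/

/-- In every direction `X`, each subgradient at `A` is dominated by the subgradient of some top
family of `A`, a limit of top families of `A + t X` as `t` decreases to `0`. -/
theorem exists_le_of_mem_subdifferential (hk : 1 ≤ k) (hkn : k ≤ n) {p : ℝ}
    (hp : 2 ≤ p) {A : Matrix (Fin m) (Fin n) ℂ} (hA : A ≠ 0)
    {ψ : Matrix (Fin m) (Fin n) ℂ →L[ℂ] ℂ} (hψ : ψ ∈ subdifferential (kyFanNorm p k) A)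
    (X : Matrix (Fin m) (Fin n) ℂ) :
    ∃ v : Fin k → EuclideanSpace ℂ (Fin n), IsTopRightSingularFamily A v ∧
      (ψ X).re ≤ (traceFunctional (kyFanSubgradient p A v) X).re := by
  set t : ℕ → ℝ := fun j => 1 / ((j : ℝ) + 1)
  have ht0 : ∀ j, 0 < t j := fun j => Nat.one_div_pos_of_nat
  have hB : Tendsto (fun j => A + t j • X) atTop (𝓝 A) := by
    have := tendsto_const_nhds (x := A).add
      ((tendsto_one_div_add_atTop_nhds_zero_nat (𝕜 := ℝ)).smul_const X)
    simpa [t] using this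
  choose w hw using fun j => exists_isTopRightSingularFamily hkn (A + t j • X)
  obtain ⟨v, -, φ, hφ, hwv⟩ := isCompact_setOf_orthonormal.tendsto_subseq fun j => (hw j).1
  have hB' := hB.comp hφ.tendsto_atTop
  have hv : IsTopRightSingularFamily A v := by
    have h := isClosed_setOf_isTopRightSingularFamily.mem_of_tendsto (hB'.prodMk_nhds hwv)
      (Eventually.of_forall fun j => hw (φ j))
    exact h
  refine ⟨v, hv, ?_⟩
  have hlim := IsTopRightSingularFamily.tendsto_re_traceFunctional hp
    (kyFanNorm_pos hk hA).ne' hB' hwv (fun j => hw (φ j)) hv X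
  refine ge_of_tendsto hlim ?_
  filter_upwards [hB'.eventually (isOpen_ne.mem_nhds hA)] with j hj
  have h1 := hψ (A + t (φ j) • X)
  have h2 := (hw (φ j)).traceFunctional_mem_subdifferential hp (kyFanNorm_pos hk hj) A
  have hre : ∀ χ : Matrix (Fin m) (Fin n) ℂ →L[ℂ] ℂ, ∀ s : ℝ, (χ (s • X)).re = s * (χ X).re := by
    intro χ s
    rw [← Complex.coe_smul, map_smul]; simp
  rw [add_sub_cancel_left, hre] at h1
  rw [sub_add_cancel_left, map_neg, Complex.neg_re, hre] at h2
  exact le_of_mul_le_mul_left (by simpa using by linarith) (ht0 (φ j))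

end KyFan

theorem mainTheorem1 (m n k : ℕ) (hk : 1 ≤ k) (hkmn : k ≤ min m n) (p : ℝ) (hp : 2 ≤ p)
    (A : Matrix (Fin m) (Fin n) ℂ) (hA : A ≠ 0) :
    subdifferential (kyFanNorm p k) A =
      traceFunctional '' convexHull ℝ
        {K : Matrix (Fin m) (Fin n) ℂ |
          ∃ v : Fin k → EuclideanSpace ℂ (Fin n),
            IsTopRightSingularFamily A v ∧ K = kyFanSubgradient p A v} := by
  apply Set.Subset.antisymm
  · intro ψ hψ
    obtain ⟨G, rfl⟩ := traceFunctional_surjective m n ψ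
    refine ⟨G, ?_, rfl⟩
    by_contra hG
    have : LocallyConvexSpace ℝ (Matrix (Fin m) (Fin n) ℂ) :=
      inferInstanceAs (LocallyConvexSpace ℝ (Fin m → Fin n → ℂ))
    obtain ⟨f, u, hfu, huG⟩ := RCLike.geometric_hahn_banach_closed_point (𝕜 := ℂ)
      (convex_convexHull ℝ _)
      (isCompact_setOf_kyFanSubgradient p A).convexHull_of_finiteDimensional.isClosed hG
    -- The separating functional is a trace functional too, so separation is by a direction `X`.
    obtain ⟨X, rfl⟩ := traceFunctional_surjective m n f
    obtain ⟨v, hv, hle⟩ := exists_le_of_mem_subdifferential hk (hkmn.trans (min_le_right _ _))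
      hp hA hψ X
    have h := hfu _ (subset_convexHull ℝ _ ⟨v, hv, rfl⟩)
    rw [re_traceFunctional_comm, re_traceFunctional_comm _ X] at hle
    exact absurd (huG.trans_le hle) h.not_gt
  · -- The identification with functionals is only conjugate linear, but it is real linear.
    let L : Matrix (Fin m) (Fin n) ℂ →ₗ[ℝ] (Matrix (Fin m) (Fin n) ℂ →L[ℂ] ℂ) :=
      { toFun := traceFunctional
        map_add' := fun G H => by
          ext X; simp [traceFunctional_apply, Matrix.add_mul]
        map_smul' := fun r G => by
          ext X; simp [traceFunctional_apply] }
    rw [Set.image_subset_iff]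
    refine convexHull_min ?_ ((convex_subdifferential (kyFanNorm p k) A).linear_preimage L)
    rintro _ ⟨v, hv, rfl⟩
    exact hv.traceFunctional_mem_subdifferential hp (kyFanNorm_pos hk hA)
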